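/- Let $G=(\mathcal V,\mathcal E)$ be a finite connected multigraph: self-loops are allowed, multiple edges are not, and we write $u - v$ if $\{u,v\}\in\mathcal E$ (so $v - v$ means that $v$ carries a self-loop). For $U\subset\mathcal V$ let $\mathcal E(U)=\{v:\exists u\in U,\ u - v\}$, and call $I\subset\mathcal V$ independent if it includes no edge (in particular, it contains no node with a self-loop). Let $\mathscr M(\mathcal V)$ be the set of probability measures on $\mathcal V$ with exact support $\mathcal V$, and $$\mathrm{Ncond}(G)=\{\mu\in\mathscr M(\mathcal V):\ \mu(I)<\mu(\mathcal E(I))\ \text{for every non-empty independent set } I\}.$$ Let $\mathbb W$ be the set of finite words $w$ over $\mathcal V$ such that $|w|_i|w|_j=0$ whenever $i\ne j$ and $i - j$, and $|w|_i\le 1$ whenever $i - i$; here $|w|_i$ is the number of occurrences of $i$ in $w$. A word lists the classes of the stored items in their order of arrival, and $x(i)=|w|_i$. Given real rewards $(r_S)_{S\in\mathcal E}$ and $\beta\in\mathbb R$, the Max-Weight policy $\Phi$ acts as follows when the state is $w$ and an item of class $v$ arrives. Let $\mathcal P(x,v)=\{j:\ v - j,\ x(j)>0\}$. If $\mathcal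 P(x,v)=\emptyset$, the item is stored and the new state is $wv$. Otherwise a class $j$ is drawn uniformly at random among the maximizers over $\mathcal P(x,v)$ of $\beta\,x(\{v,j\})+r_{\{v,j\}}$, where $x(S)=\sum_{i\in S}x(i)$, and the incoming item leaves together with the oldest stored item of class $j$, so that the new state is $w$ with its first letter $j$ deleted. For $\mu\in\mathscr M(\mathcal V)$, let $(W_n)$ be the resulting Markov chain on $\mathbb W$ when the classes of the successive items are i.i.d. with law $\mu$, and let $$\mathrm{Stab}(G,\Phi)=\{\mu\in\mathscr M(\mathcal V):\ (W_n)\ \text{is positive recurrent}\},$$ where positive recurrent means that for every $w\in\mathbb W$ the mean return time to $w$ of the chain started at $w$ is finite. **Theorem.** If $G$ is not a bipartite graph (that is, it is not the case that $G$ has no self-loop and $\mathcal V$ is the union of two disjoint, possibly empty, independent sets), then every Max-Weight policy $\Phi$ with $\beta>0$, whatever its rewards, is maximal: $$\mathrm{Stab}(G,\Phi)=\mathrm{Ncond}(G).$$ -/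

import Mathlib

/-- A multigraph on the vertex set `V`: self-loops are allowed, multiple edges are not, so that
the edge set is a symmetric relation (`Adj v v` says that there is a self-loop at `v`). -/
structure Multigraph (V : Type*) where
  Adj : V → V → Prop
  symm : ∀ u v, Adj u v → Adj v u

namespace Multigraph

variable {V : Type*} (G : Multigraph V)

/-- Any two vertices are joined by a chain of edges. -/
def Connected : Prop := ∀ u v, Relation.ReflTransGen G.Adj u v

/-- An independent set includes no edge; in particular it contains no vertex with a self-loop. -/
def IsIndep (I : Set V) : Prop := ∀ u ∈ I, ∀ v ∈ I, ¬ G.Adj u v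

/-- A bipartite graph: there is no self-loop, and the vertex set splits into two independent
sets. -/
def IsBipartiteGraph : Prop :=
  (∀ v, ¬ G.Adj v v) ∧ ∃ A : Set V, G.IsIndep A ∧ G.IsIndep Aᶜ

open Classical in
/-- The neighborhood `E(U)` of a set `U` of vertices. -/
noncomputable def nbhd [Fintype V] (U : Finset V) : Finset V :=
  Finset.univ.filter fun v => ∃ u ∈ U, G.Adj u v

end Multigraph

/-- The probability measures on `V` having `V` as exact support. -/
def fullSupportMeasures (V : Type*) : Set (PMF V) := {μ | ∀ v, μ v ≠ 0}

/-- `Ncond(G)`: the probability measures `μ` with full support such that `μ(I) < μ(E(I))` for every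
non-empty independent set `I`. -/
def Multigraph.Ncond {V : Type*} [Fintype V] (G : Multigraph V) : Set (PMF V) :=
  {μ | μ ∈ fullSupportMeasures V ∧
    ∀ I : Finset V, I.Nonempty → G.IsIndep (I : Set V) →
      ∑ i ∈ I, μ i < ∑ i ∈ G.nbhd I, μ i}

section MarkovChain

variable {S : Type*}

/-- The law of `(X₁, …, Xₙ)` for the homogeneous Markov chain with transition probabilities `κ`
and initial state `X₀ = x`. -/
noncomputable def pathLaw (κ : S → PMF S) : ℕ → S → PMF (List S)
  | 0, _ => PMF.pure []
  | n + 1, x => (κ x).bind fun y => (pathLaw κ n y).map fun l => y :: l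

/-- `E_x[T_x] = ∑_{n ≥ 0} P_x(T_x > n)` for the return time `T_x = inf {n ≥ 1 : Xₙ = x}`;
the event `T_x > n` says that `x` is not among `X₁, …, Xₙ`. -/
noncomputable def meanReturnTime (κ : S → PMF S) (x : S) : ENNReal :=
  ∑' n : ℕ, (pathLaw κ n x).toOuterMeasure {l | x ∉ l}

/-- Every state has a finite mean return time. -/
def PositiveRecurrent (κ : S → PMF S) : Prop := ∀ x, meanReturnTime κ x < ⊤

end MarkovChain

namespace Multigraph

variable {V : Type*} [DecidableEq V] (G : Multigraph V)

/-- `w` is an admissible queue detail: no two stored items (at different positions of the word) are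
of compatible classes. Words list the stored items in their order of arrival, oldest first. -/
def IsQueueDetail (w : List V) : Prop :=
  (∀ i j, i ≠ j → G.Adj i j → w.count i * w.count j = 0) ∧ ∀ i, G.Adj i i → w.count i ≤ 1

/-- The state space of queue details. -/
abbrev QueueDetail : Type _ := {w : List V // G.IsQueueDetail w}

theorem IsQueueDetail.erase {G : Multigraph V} {w : List V} (hw : G.IsQueueDetail w) (j : V) :
    G.IsQueueDetail (w.erase j) := by
  have hle : ∀ i, (w.erase j).count i ≤ w.count i := fun i =>
    (List.erase_sublist (a := j) (l := w)).count_le i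
  refine ⟨fun i k hik h => ?_, fun i h => (hle i).trans (hw.2 i h)⟩
  exact Nat.le_zero.mp ((Nat.mul_le_mul (hle i) (hle k)).trans (hw.1 i k hik h).le)

/-- The class detail (commutative image) of a word. -/
def classDetail (w : List V) : V → ℕ := fun i => w.count i

variable [Fintype V]

open Classical in
/-- The classes of the stored items that are compatible with an incoming item of class `v`, if the
class detail is `x`. The class `v` itself is among them if `v` has a self-loop and an item
of class `v` is stored. -/
noncomputable def available (x : V → ℕ) (v : V) : Finset V :=
  Finset.univ.filter fun j => G.Adj v j ∧ 0 < x j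

/-- A class-admissible matching policy: given the class detail and the class of the incoming item,
it draws the class of the match, among the available ones, whenever there is one. -/
structure ClassPolicy where
  choice : (x : V → ℕ) → (v : V) → (G.available x v).Nonempty → PMF V
  support_subset : ∀ x v h, (choice x v h).support ⊆ (G.available x v : Set V)

theorem IsQueueDetail.append {G : Multigraph V} {w : List V} (hw : G.IsQueueDetail w) {v : V}
    (hv : ¬ (G.available (classDetail w) v).Nonempty) : G.IsQueueDetail (w ++ [v]) := by
  have h0 : ∀ j, G.Adj v j → w.count j = 0 := by
    intro j hj
    by_contra hne
    refine hv ⟨j, ?_⟩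
    simp only [available, Finset.mem_filter]
    exact ⟨Finset.mem_univ j, hj, Nat.pos_of_ne_zero hne⟩
  have hc : ∀ i, i ≠ v → (w ++ [v]).count i = w.count i := by
    intro i hi
    simp [List.count_append, Ne.symm hi]
  refine ⟨fun i k hik h => ?_, fun i h => ?_⟩
  · by_cases hi : i = v
    · subst hi
      rw [hc k (Ne.symm hik), h0 k h, Nat.mul_zero]
    · by_cases hk : k = v
      · subst hk
        rw [hc i hi, h0 i (G.symm _ _ h), Nat.zero_mul]
      · rw [hc i hi, hc k hk, hw.1 i k hik h]
  · by_cases hi : i = v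
    · subst hi
      simp [List.count_append, h0 i h]
    · rw [hc i hi]
      exact hw.2 i h

open Classical in
/-- The random action of an incoming item of class `v` on the queue detail `w`: if some stored item
is compatible, the policy draws the class of the match and the oldest stored item of that class
leaves; otherwise the incoming item is stored. -/
noncomputable def arrival (Φ : G.ClassPolicy) (w : G.QueueDetail) (v : V) : PMF G.QueueDetail :=
  if h : (G.available (classDetail w.1) v).Nonempty then
    (Φ.choice (classDetail w.1) v h).map fun j => ⟨w.1.erase j, w.2.erase j⟩
  else PMF.pure ⟨w.1 ++ [v], w.2.append h⟩

/-- The transition probabilities of the chain `(Wₙ)` of queue details: the class of the incoming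
item is drawn from `μ`, independently of everything else. -/
noncomputable def transition (Φ : G.ClassPolicy) (μ : PMF V) (w : G.QueueDetail) :
    PMF G.QueueDetail :=
  μ.bind fun v => G.arrival Φ w v

/-- The stability region `Stab(G, Φ)`. -/
def Stab (Φ : G.ClassPolicy) : Set (PMF V) :=
  {μ | μ ∈ fullSupportMeasures V ∧ PositiveRecurrent (G.transition Φ μ)}

/-- The weight `β x(S) + r(S)` of the edge `S = {v, j}`, where `x(S)` is the sum of `x` over the
set `S` and `r(S)` is the reward of the edge. -/
def weight (β : ℝ) (r : Sym2 V → ℝ) (x : V → ℕ) (v j : V) : ℝ :=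
  β * ∑ i ∈ ({v, j} : Finset V), (x i : ℝ) + r s(v, j)

open Classical in
/-- The available classes `j` for which the edge `{v, j}` has the largest weight. -/
noncomputable def maximizers (β : ℝ) (r : Sym2 V → ℝ) (x : V → ℕ) (v : V) : Finset V :=
  (G.available x v).filter fun j => ∀ k ∈ G.available x v, weight β r x v k ≤ weight β r x v j

theorem maximizers_nonempty (β : ℝ) (r : Sym2 V → ℝ) (x : V → ℕ) (v : V)
    (h : (G.available x v).Nonempty) : (G.maximizers β r x v).Nonempty := by
  obtain ⟨j, hj, hmax⟩ := Finset.exists_max_image _ (weight β r x v) h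
  exact ⟨j, Finset.mem_filter.mpr ⟨hj, hmax⟩⟩

/-- The Max-Weight policy with parameter `β` and rewards `r`; ties are broken uniformly at
random. -/
noncomputable def maxWeight (β : ℝ) (r : Sym2 V → ℝ) : G.ClassPolicy where
  choice x v h := PMF.uniformOfFinset (G.maximizers β r x v) (G.maximizers_nonempty β r x v h)
  support_subset x v h := by
    intro j hj
    rw [PMF.mem_support_uniformOfFinset_iff] at hj
    exact Finset.mem_coe.mpr (Finset.mem_filter.mp hj).1

end Multigraph

/-! Necessity holds for every class-admissible policy. Let `I` be a non-empty independent set with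
`μ(I) ≥ μ(E(I))`. An item of `I` can only be matched with one of `E(I)`, so an arrival of class `v`
raises the number of stored items in `I` minus the number in `E(I)` by at least `1_I(v) -
1_{E(I)}(v)`, of mean at least `0`. As `G` is not bipartite, some `e ∈ E(I)` has a neighbor `u ∉ I`;
their match makes the drift positive at the word `[e]`. The part of this difference surviving until
time `n` before the return to the empty word then has mean at least some `c > 0`, yet it is at most
`n`. So `P(T > n) ≥ c / n`, and the mean return time diverges, even when `μ(I) = μ(E(I))`.

Sufficiency uses the Lyapunov function `∑ x(i)²`. Let `m(v)` be the largest `x(j)` over the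
neighbors `j` of `v`. Max-Weight with `β > 0` picks a class within a constant of `m(v)`, so the mean
drift is at most `2 E[x(v)] - 2 E[m(v)]` plus a constant. By the layer-cake formula both means are
sums over levels `t`, and `{m > t} = E({x > t})`, where `{x > t}` is independent for `t ≥ 1`.
`Ncond` yields a gap `ε` at each level below `max x`, hence a drift of order `-2 ε max x`, and
Foster's criterion applies.

The pillars are `countP_arrival_le` with `not_positiveRecurrent_of_drift`, and `expect_count_add_le`
with `positiveRecurrent_of_drift`. Quantities live in `ℝ≥0∞`, so drift bounds are written without
subtraction. -/

open scoped ENNReal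

/-! ### Expectations under discrete laws -/

/-- The expectation of a nonnegative function under a discrete law. -/
noncomputable def PMF.expect {α : Type*} (p : PMF α) (g : α → ℝ≥0∞) : ℝ≥0∞ := ∑' y, p y * g y

namespace PMF

variable {α γ : Type*}

theorem expect_add (p : PMF α) (f g : α → ℝ≥0∞) :
    p.expect (fun y => f y + g y) = p.expect f + p.expect g := by
  simp only [expect, mul_add]
  exact ENNReal.tsum_add

theorem expect_const_mul (p : PMF α) (c : ℝ≥0∞) (g : α → ℝ≥0∞) :
    p.expect (fun y => c * g y) = c * p.expect g := by
  simp only [expect, ← ENNReal.tsum_mul_left]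
  exact tsum_congr fun y => mul_left_comm _ _ _

theorem expect_const (p : PMF α) (c : ℝ≥0∞) : p.expect (fun _ => c) = c := by
  simp only [expect, ENNReal.tsum_mul_right, p.tsum_coe, one_mul]

theorem expect_mono (p : PMF α) {f g : α → ℝ≥0∞} (h : ∀ y, p y ≠ 0 → f y ≤ g y) :
    p.expect f ≤ p.expect g := by
  refine ENNReal.tsum_le_tsum fun y => ?_
  by_cases hy : p y = 0
  · simp [hy]
  · exact mul_le_mul_right (h y hy) _

theorem mul_le_expect (p : PMF α) (g : α → ℝ≥0∞) (y : α) : p y * g y ≤ p.expect g :=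
  ENNReal.le_tsum (f := fun y => p y * g y) y

theorem expect_bind (p : PMF α) (q : α → PMF γ) (g : γ → ℝ≥0∞) :
    (p.bind q).expect g = p.expect fun a => (q a).expect g := by
  simp only [expect, bind_apply, ← ENNReal.tsum_mul_right, ← ENNReal.tsum_mul_left]
  rw [ENNReal.tsum_comm]
  exact tsum_congr fun a => tsum_congr fun b => mul_assoc _ _ _

theorem expect_lt_one (p : PMF α) {g : α → ℝ≥0∞} (hg : ∀ y, g y ≤ 1) {z : α} (hz : p z ≠ 0)
    (hgz : g z < 1) : p.expect g < 1 := by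
  have h1 : p.expect g ≤ 1 := (p.expect_mono fun y _ => hg y).trans (p.expect_const 1).le
  have h : p.expect g + p z * (1 - g z) ≤ 1 := calc
    p.expect g + p z * (1 - g z) ≤ p.expect g + p.expect (fun y => 1 - g y) := by
      gcongr; exact p.mul_le_expect (fun y => 1 - g y) z
    _ = p.expect (fun _ => 1) := by
      rw [← expect_add]
      exact congrArg _ (funext fun y => add_tsub_cancel_of_le (hg y))
    _ = 1 := p.expect_const 1
  refine lt_of_lt_of_le (ENNReal.lt_add_right (h1.trans_lt ENNReal.one_lt_top).ne ?_) h
  exact mul_ne_zero hz (tsub_pos_of_lt hgz).ne'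

end PMF

/-! ### The chain killed on entering a state -/

section Taboo

variable {S : Type*} (κ : S → PMF S) (a : S)

/-- The transition operator of the chain killed when it enters the state `a`. -/
noncomputable def tabooOp (f : S → ℝ≥0∞) (x : S) : ℝ≥0∞ := (κ x).expect (({a}ᶜ : Set S).indicator f)

/-- `tabooIter κ a n f x` is the expectation of `f Xₙ` on the event that the chain started
at `x` is not at `a` at any of the times `1, …, n`. -/
noncomputable def tabooIter (n : ℕ) (f : S → ℝ≥0∞) : S → ℝ≥0∞ := (tabooOp κ a)^[n] f

theorem tabooIter_zero (f : S → ℝ≥0∞) : tabooIter κ a 0 f = f := rfl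

theorem tabooIter_succ (n : ℕ) (f : S → ℝ≥0∞) :
    tabooIter κ a (n + 1) f = tabooIter κ a n (tabooOp κ a f) := rfl

theorem tabooIter_succ' (n : ℕ) (f : S → ℝ≥0∞) :
    tabooIter κ a (n + 1) f = tabooOp κ a (tabooIter κ a n f) :=
  Function.iterate_succ_apply' _ _ _

theorem tabooIter_add (m n : ℕ) (f : S → ℝ≥0∞) :
    tabooIter κ a (m + n) f = tabooIter κ a m (tabooIter κ a n f) :=
  Function.iterate_add_apply _ _ _ _

theorem tabooOp_add (f g : S → ℝ≥0∞) :
    tabooOp κ a (f + g) = tabooOp κ a f + tabooOp κ a g := by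
  funext x
  rw [tabooOp, Set.indicator_add']
  exact PMF.expect_add _ _ _

theorem tabooOp_mono {f g : S → ℝ≥0∞} (h : f ≤ g) : tabooOp κ a f ≤ tabooOp κ a g :=
  fun x => (κ x).expect_mono fun y _ => Set.indicator_le_indicator (h y)

theorem tabooOp_smul (c : ℝ≥0∞) (f : S → ℝ≥0∞) : tabooOp κ a (c • f) = c • tabooOp κ a f := by
  funext x
  have h : ({a}ᶜ : Set S).indicator (c • f) = fun y => c * ({a}ᶜ : Set S).indicator f y :=
    Set.indicator_const_smul _ c f
  rw [tabooOp, h]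
  exact PMF.expect_const_mul _ _ _

theorem tabooOp_le_expect (f : S → ℝ≥0∞) (x : S) : tabooOp κ a f x ≤ (κ x).expect f :=
  (κ x).expect_mono fun _ _ => Set.indicator_le_self _ _ _

theorem tabooOp_eq_expect {f : S → ℝ≥0∞} (hf : f a = 0) (x : S) :
    tabooOp κ a f x = (κ x).expect f := by
  rw [tabooOp, Set.indicator_eq_self.2]
  intro y hy hya
  exact hy ((congrArg f hya).trans hf)

theorem tabooIter_sum {ι : Type*} (n : ℕ) (s : Finset ι) (f : ι → S → ℝ≥0∞) :
    tabooIter κ a n (∑ i ∈ s, f i) = ∑ i ∈ s, tabooIter κ a n (f i) := by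
  have h0 : tabooOp κ a 0 = 0 := by
    have := tabooOp_smul κ a 0 0
    simpa using this
  induction n generalizing f with
  | zero => rfl
  | succ n ih =>
    simp only [tabooIter_succ]
    rw [← ih]
    congr 1
    exact map_sum (⟨⟨tabooOp κ a, h0⟩, tabooOp_add κ a⟩ : (S → ℝ≥0∞) →+ (S → ℝ≥0∞)) f s

theorem tabooIter_add_fun (n : ℕ) (f g : S → ℝ≥0∞) :
    tabooIter κ a n (f + g) = tabooIter κ a n f + tabooIter κ a n g := by
  induction n generalizing f g with
  | zero => rfl
  | succ n ih => rw [tabooIter_succ, tabooOp_add, ih]; rfl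

theorem tabooIter_smul (n : ℕ) (c : ℝ≥0∞) (f : S → ℝ≥0∞) :
    tabooIter κ a n (c • f) = c • tabooIter κ a n f := by
  induction n generalizing f with
  | zero => rfl
  | succ n ih => rw [tabooIter_succ, tabooOp_smul, ih]; rfl

theorem tabooIter_mono (n : ℕ) {f g : S → ℝ≥0∞} (h : f ≤ g) :
    tabooIter κ a n f ≤ tabooIter κ a n g := by
  induction n generalizing f g with
  | zero => exact h
  | succ n ih => exact ih (tabooOp_mono κ a h)

theorem tabooIter_one_le_one (n : ℕ) (x : S) : tabooIter κ a n 1 x ≤ 1 := by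
  induction n generalizing x with
  | zero => exact le_rfl
  | succ n ih =>
    rw [tabooIter_succ']
    exact (tabooOp_le_expect κ a _ x).trans
      (((κ x).expect_mono fun y _ => ih y).trans ((κ x).expect_const 1).le)

/-- The probability that the first `n` steps avoid `a`. -/
theorem toOuterMeasure_pathLaw (n : ℕ) (x : S) :
    (pathLaw κ n x).toOuterMeasure {l | a ∉ l} = tabooIter κ a n 1 x := by
  classical
  induction n generalizing x with
  | zero => simp [pathLaw, tabooIter_zero, PMF.toOuterMeasure_pure_apply]
  | succ n ih =>
    rw [tabooIter_succ', pathLaw, PMF.toOuterMeasure_bind_apply]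
    refine tsum_congr fun y => ?_
    rw [PMF.toOuterMeasure_map_apply]
    by_cases hy : y = a
    · subst hy
      have : (fun l => y :: l) ⁻¹' {l : List S | y ∉ l} = ∅ := by ext l; simp
      rw [this]
      simp
    · have : (fun l => y :: l) ⁻¹' {l : List S | a ∉ l} = {l | a ∉ l} := by
        ext l; simp [Ne.symm hy]
      rw [this, ih, Set.indicator_of_mem (by simpa using hy)]

theorem meanReturnTime_eq : meanReturnTime κ a = ∑' n, tabooIter κ a n 1 a :=
  tsum_congr fun n => toOuterMeasure_pathLaw κ a n a

/-- Each step of a path to `a` has positive probability, and its last step kills. The path needs at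
least one step, since starting at `a` does not kill. -/
theorem exists_tabooIter_lt_one {y : S} (h : Relation.TransGen (fun x y => κ x y ≠ 0) y a) :
    ∃ k, tabooIter κ a k 1 y < 1 := by
  have hle : ∀ k z, ({a}ᶜ : Set S).indicator (tabooIter κ a k 1) z ≤ 1 := fun k z =>
    (Set.indicator_le_self _ _ _).trans (tabooIter_one_le_one κ a k z)
  induction h using Relation.TransGen.head_induction_on with
  | single h =>
    refine ⟨1, PMF.expect_lt_one _ (hle 0) h ?_⟩
    simp
  | head h _ ih =>
    obtain ⟨k, hk⟩ := ih
    refine ⟨k + 1, ?_⟩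
    rw [tabooIter_succ']
    exact PMF.expect_lt_one _ (hle k) h ((Set.indicator_le_self _ _ _).trans_lt hk)

/-- The expected number of visits to `y` before the chain enters `a` is finite if `a` is
accessible from `y`. -/
theorem tsum_tabooIter_indicator_lt_top {y : S}
    (h : Relation.TransGen (fun x y => κ x y ≠ 0) y a) (x : S) :
    ∑' n, tabooIter κ a n (({y} : Set S).indicator 1) x < ⊤ := by
  obtain ⟨k, hk⟩ := exists_tabooIter_lt_one κ a h
  set δ := 1 - tabooIter κ a k 1 y with hδ
  have hδ0 : δ ≠ 0 := (tsub_pos_of_lt hk).ne'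
  set e : S → ℝ≥0∞ := ({y} : Set S).indicator 1 with he
  -- From `y` the chain is killed within `k` steps with probability `δ`. Hence each expected visit
  -- to `y` costs `δ` of the survival probability `k` steps later; summed over time, the loss
  -- telescopes to at most `k`.
  have key : tabooIter κ a k 1 + δ • e ≤ 1 := by
    intro z
    by_cases hz : z = y
    · subst hz
      simp only [Pi.add_apply, Pi.smul_apply, he, Set.indicator_of_mem (Set.mem_singleton z),
        Pi.one_apply, smul_eq_mul, mul_one, hδ]
      exact (add_tsub_cancel_of_le hk.le).le
    · simp only [Pi.add_apply, Pi.smul_apply, he,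
        Set.indicator_of_notMem (Set.mem_singleton_iff.not.2 hz), smul_zero, add_zero]
      exact tabooIter_one_le_one κ a k z
  have step : ∀ n, tabooIter κ a (n + k) 1 x + δ * tabooIter κ a n e x ≤ tabooIter κ a n 1 x := by
    intro n
    have := tabooIter_mono κ a n key x
    rwa [tabooIter_add_fun, tabooIter_smul, ← tabooIter_add] at this
  have bound : ∀ N, δ * ∑ n ∈ Finset.range N, tabooIter κ a n e x ≤ k := by
    intro N
    have hfin : ∑ n ∈ Finset.range N, tabooIter κ a (n + k) 1 x ≠ ⊤ :=
      ENNReal.sum_ne_top.2 fun n _ =>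
        ((tabooIter_one_le_one κ a _ x).trans_lt ENNReal.one_lt_top).ne
    refine (ENNReal.add_le_add_iff_left hfin).1 ?_
    calc _ = ∑ n ∈ Finset.range N, (tabooIter κ a (n + k) 1 x + δ * tabooIter κ a n e x) := by
          rw [Finset.sum_add_distrib, Finset.mul_sum]
      _ ≤ ∑ n ∈ Finset.range N, tabooIter κ a n 1 x := Finset.sum_le_sum fun n _ => step n
      _ ≤ ∑ n ∈ Finset.range (k + N), tabooIter κ a n 1 x :=
          Finset.sum_le_sum_of_subset (Finset.range_mono (Nat.le_add_left _ _))
      _ = ∑ n ∈ Finset.range k, tabooIter κ a n 1 x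
            + ∑ n ∈ Finset.range N, tabooIter κ a (n + k) 1 x := by
          rw [Finset.sum_range_add]
          simp only [add_comm k]
      _ ≤ k + ∑ n ∈ Finset.range N, tabooIter κ a (n + k) 1 x := by
          gcongr
          refine (Finset.sum_le_sum fun n _ => tabooIter_one_le_one κ a n x).trans ?_
          simp
      _ = _ := add_comm _ _
  have hle : δ * ∑' n, tabooIter κ a n e x ≤ k := by
    rw [ENNReal.tsum_eq_iSup_nat, ENNReal.mul_iSup]
    exact iSup_le bound
  refine lt_top_iff_ne_top.2 fun htop => ?_
  rw [htop, ENNReal.mul_top hδ0] at hle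
  exact ENNReal.natCast_ne_top k (top_le_iff.1 hle)

end Taboo

/-! ### Drift criteria for and against positive recurrence -/

/-- **Foster's criterion**: an irreducible chain with a Lyapunov function whose drift is at most
`-1` off a finite set, and bounded above on it, is positive recurrent. -/
theorem positiveRecurrent_of_drift {S : Type*} (κ : S → PMF S)
    (hirr : ∀ x y, Relation.ReflTransGen (fun x y => κ x y ≠ 0) x y)
    (L : S → ℝ≥0∞) (hL : ∀ x, L x ≠ ⊤) (F : Finset S) (c : ℝ≥0∞) (hc : c ≠ ⊤)
    (hin : ∀ x ∈ F, (κ x).expect L + 1 ≤ L x + c) (hout : ∀ x ∉ F, (κ x).expect L + 1 ≤ L x) :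
    PositiveRecurrent κ := by
  classical
  intro a
  rw [meanReturnTime_eq]
  -- An arbitrary first step makes the path non-trivial, also when `y = a`.
  have htrans : ∀ y, Relation.TransGen (fun x y => κ x y ≠ 0) y a := fun y => by
    obtain ⟨z, hz⟩ := (κ y).support_nonempty
    exact Relation.TransGen.head' ((κ y).mem_support_iff z |>.1 hz) (hirr z a)
  set e : S → S → ℝ≥0∞ := fun y => ({y} : Set S).indicator 1 with he
  have drift : tabooOp κ a L + 1 ≤ L + c • ∑ y ∈ F, e y := by
    intro x
    have h1 : tabooOp κ a L x + 1 ≤ (κ x).expect L + 1 := by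
      gcongr; exact tabooOp_le_expect κ a L x
    by_cases hx : x ∈ F
    · refine h1.trans ((hin x hx).trans ?_)
      simp only [Pi.add_apply, Pi.smul_apply, Finset.sum_apply, smul_eq_mul]
      gcongr
      have : 1 ≤ ∑ y ∈ F, e y x := by
        refine le_trans ?_ (Finset.single_le_sum (fun _ _ => zero_le) hx)
        simp [he]
      simpa using mul_le_mul_right this c
    · exact h1.trans ((hout x hx).trans le_self_add)
  have step : ∀ n, tabooIter κ a (n + 1) L a + tabooIter κ a n 1 a
      ≤ tabooIter κ a n L a + c * ∑ y ∈ F, tabooIter κ a n (e y) a := by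
    intro n
    have := tabooIter_mono κ a n drift a
    rw [tabooIter_add_fun, tabooIter_add_fun, tabooIter_smul, tabooIter_sum] at this
    simpa [tabooIter_succ] using this
  -- Telescoped drift: the partial sums of the mean return time are controlled by `L a` and the
  -- expected visits to `F` before the return.
  have hsum : ∀ N, tabooIter κ a N L a + ∑ n ∈ Finset.range N, tabooIter κ a n 1 a
      ≤ L a + c * ∑ n ∈ Finset.range N, ∑ y ∈ F, tabooIter κ a n (e y) a := by
    intro N
    induction N with
    | zero => simp [tabooIter_zero]
    | succ N ih =>
      rw [Finset.sum_range_succ, Finset.sum_range_succ, mul_add, ← add_assoc (L a)]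
      calc _ = (tabooIter κ a (N + 1) L a + tabooIter κ a N 1 a)
            + ∑ n ∈ Finset.range N, tabooIter κ a n 1 a := by ring
        _ ≤ (tabooIter κ a N L a + c * ∑ y ∈ F, tabooIter κ a N (e y) a)
            + ∑ n ∈ Finset.range N, tabooIter κ a n 1 a :=
            add_le_add (step N) le_rfl
        _ = (tabooIter κ a N L a + ∑ n ∈ Finset.range N, tabooIter κ a n 1 a)
            + c * ∑ y ∈ F, tabooIter κ a N (e y) a := by ring
        _ ≤ _ := by gcongr
  have hfin : L a + c * ∑ y ∈ F, ∑' n, tabooIter κ a n (e y) a < ⊤ := by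
    refine ENNReal.add_lt_top.2 ⟨(hL a).lt_top, ENNReal.mul_lt_top hc.lt_top ?_⟩
    exact ENNReal.sum_lt_top.2 fun y _ => tsum_tabooIter_indicator_lt_top κ a (htrans y) a
  refine lt_of_le_of_lt ?_ hfin
  rw [ENNReal.tsum_eq_iSup_nat]
  refine iSup_le fun N => le_add_self.trans ((hsum N).trans ?_)
  rw [Finset.sum_comm]
  gcongr
  exact ENNReal.sum_le_tsum _

/-- A chain is not positive recurrent if, for functions `h` and `l` of at most linear growth along
the chain and vanishing at `a`, the drift of `h - l` is nonnegative everywhere and positive at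
some state that can be reached from `a` in one step. -/
theorem not_positiveRecurrent_of_drift {S : Type*} (κ : S → PMF S) (a z : S)
    (len : S → ℕ) (hlen : ∀ x y, κ x y ≠ 0 → len y ≤ len x + 1) (hlena : len a = 0)
    (h l d : S → ℝ≥0∞) (hh : ∀ x, h x ≤ len x) (hl : ∀ x, l x ≤ len x)
    (hdrift : ∀ x, h x + (κ x).expect l + d x ≤ (κ x).expect h + l x)
    (hza : z ≠ a) (hz : κ a z ≠ 0) (hd : d z ≠ 0) : ¬ PositiveRecurrent κ := by
  intro hpr
  have hfin := hpr a
  rw [meanReturnTime_eq] at hfin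
  have hha : h a = 0 := by simpa [hlena] using hh a
  have hla : l a = 0 := by simpa [hlena] using hl a
  -- `len` grows by at most one per step, so on survival `len Xₙ ≤ len x + n`.
  have growth : ∀ n x, tabooIter κ a n (fun x => (len x : ℝ≥0∞)) x
      ≤ (len x + n : ℕ) * tabooIter κ a n 1 x := by
    intro n
    induction n with
    | zero => intro x; simp [tabooIter_zero]
    | succ n ih =>
      intro x
      rw [tabooIter_succ', tabooIter_succ']
      simp only [tabooOp]
      rw [← PMF.expect_const_mul]
      refine (κ x).expect_mono fun y hy => ?_
      by_cases hya : y = a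
      · simp [hya]
      · rw [Set.indicator_of_mem (by simpa using hya), Set.indicator_of_mem (by simpa using hya)]
        refine (ih y).trans ?_
        gcongr ?_ * _
        have := hlen x y hy
        exact_mod_cast (by omega)
  have growtha : ∀ n, tabooIter κ a n (fun x => (len x : ℝ≥0∞)) a ≤ n * tabooIter κ a n 1 a := by
    intro n; simpa [hlena] using growth n a
  -- Finiteness of these terms allows their cancellation in `hsum`.
  have hIl : ∀ n, tabooIter κ a n l a ≠ ⊤ := fun n => by
    refine ne_top_of_le_ne_top ?_ ((tabooIter_mono κ a n hl a).trans (growtha n))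
    exact ENNReal.mul_ne_top (ENNReal.natCast_ne_top n)
      ((tabooIter_one_le_one κ a n a).trans_lt ENNReal.one_lt_top).ne
  -- Both `h` and `l` vanish at `a`, so killing there does not affect the drift inequality.
  have hop : h + tabooOp κ a l + d ≤ tabooOp κ a h + l := by
    intro x
    simp only [Pi.add_apply, tabooOp_eq_expect κ a hha, tabooOp_eq_expect κ a hla]
    exact hdrift x
  have step : ∀ n, tabooIter κ a n h a + tabooIter κ a (n + 1) l a + tabooIter κ a n d a
      ≤ tabooIter κ a (n + 1) h a + tabooIter κ a n l a := by
    intro n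
    have := tabooIter_mono κ a n hop a
    rw [tabooIter_add_fun, tabooIter_add_fun, tabooIter_add_fun] at this
    simpa [tabooIter_succ] using this
  have hsum : ∀ N, tabooIter κ a N l a + ∑ n ∈ Finset.range N, tabooIter κ a n d a
      ≤ tabooIter κ a N h a := by
    intro N
    induction N with
    | zero => simp [tabooIter_zero, hla]
    | succ N ih =>
      rw [Finset.sum_range_succ]
      refine (ENNReal.add_le_add_iff_right (hIl N)).1 (le_trans ?_ (step N))
      calc _ = (tabooIter κ a N l a + ∑ n ∈ Finset.range N, tabooIter κ a n d a)
            + tabooIter κ a (N + 1) l a + tabooIter κ a N d a := by ring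
        _ ≤ _ := by gcongr
  set c := tabooIter κ a 1 d a with hcdef
  have hc : c ≠ 0 := by
    have h1 : κ a z * d z ≤ c := by
      have := (κ a).mul_le_expect (({a}ᶜ : Set S).indicator d) z
      rwa [Set.indicator_of_mem (by simpa using hza)] at this
    intro h0
    rw [h0] at h1
    exact mul_ne_zero hz hd (le_zero_iff.1 h1)
  -- The gain `c` is collected at time `1`, so it is present in the sums up to any horizon `N + 2`;
  -- the surviving mean of `h` is at most the horizon times the survival probability.
  have lower : ∀ N : ℕ, c * ((N + 2 : ℕ) : ℝ≥0∞)⁻¹ ≤ tabooIter κ a (N + 2) 1 a := by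
    intro N
    have h1 : c ≤ ((N + 2 : ℕ) : ℝ≥0∞) * tabooIter κ a (N + 2) 1 a := calc
      c ≤ ∑ n ∈ Finset.range (N + 2), tabooIter κ a n d a :=
        Finset.single_le_sum (f := fun n => tabooIter κ a n d a) (fun _ _ => zero_le)
          (Finset.mem_range.2 (by omega : 1 < N + 2))
      _ ≤ tabooIter κ a (N + 2) h a := le_add_self.trans (hsum (N + 2))
      _ ≤ _ := (tabooIter_mono κ a (N + 2) hh a).trans (growtha (N + 2))
    rw [← div_eq_mul_inv]
    exact ENNReal.div_le_of_le_mul' h1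
  have hdiv : ∑' N : ℕ, ((N + 2 : ℕ) : ℝ≥0∞)⁻¹ = ⊤ := by
    by_contra hne
    have hs : Summable fun N : ℕ => (((N + 2 : ℕ) : NNReal)⁻¹) := by
      refine ENNReal.tsum_coe_ne_top_iff_summable.1 ?_
      convert hne using 4 with N
      rw [ENNReal.coe_inv (by positivity)]
      simp
    have hs' : Summable fun N : ℕ => (((N + 2 : ℕ) : ℝ)⁻¹) := by
      have := NNReal.summable_coe.2 hs
      simpa using this
    exact Real.not_summable_natCast_inv ((summable_nat_add_iff 2).1 hs')
  have : (⊤ : ℝ≥0∞) ≤ ∑' n, tabooIter κ a n 1 a := calc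
    ⊤ = c * ∑' N : ℕ, ((N + 2 : ℕ) : ℝ≥0∞)⁻¹ := by rw [hdiv, ENNReal.mul_top hc]
    _ = ∑' N : ℕ, c * ((N + 2 : ℕ) : ℝ≥0∞)⁻¹ := ENNReal.tsum_mul_left.symm
    _ ≤ ∑' N : ℕ, tabooIter κ a (N + 2) 1 a := ENNReal.tsum_le_tsum lower
    _ ≤ _ := ENNReal.tsum_comp_le_tsum_of_injective (add_left_injective 2) _
  exact hfin.ne (top_le_iff.1 this)

/-! ### Finite sums, independent sets and neighborhoods -/

theorem PMF.expect_eq_sum {α : Type*} [Fintype α] (p : PMF α) (g : α → ℝ≥0∞) :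
    p.expect g = ∑ y, p y * g y := tsum_fintype _

theorem PMF.expect_ite_mem {α : Type*} [DecidableEq α] (p : PMF α) (I : Finset α) :
    p.expect (fun y => if y ∈ I then 1 else 0) = ∑ y ∈ I, p y := by
  rw [PMF.expect, tsum_eq_sum (s := I) fun y hy => by simp [hy]]
  exact Finset.sum_congr rfl fun y hy => by simp [hy]

theorem PMF.sum_le_one {α : Type*} (p : PMF α) (I : Finset α) : ∑ y ∈ I, p y ≤ 1 :=
  (ENNReal.sum_le_tsum I).trans p.tsum_coe.le

namespace Multigraph

variable {V : Type*} {G : Multigraph V}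

/-- An isolated vertex would be the whole connected graph, which is then bipartite with an empty
part. Thus every stored item can leave. -/
theorem exists_adj (hconn : G.Connected) (hbip : ¬ G.IsBipartiteGraph) (v : V) :
    ∃ u, G.Adj v u := by
  by_contra! hv
  have huniq : ∀ u, u = v := fun u => by
    rcases Relation.ReflTransGen.cases_head (hconn v u) with h | ⟨c, hc, _⟩
    · exact h.symm
    · exact absurd hc (hv c)
  have hno : ∀ u w, ¬ G.Adj u w := fun u w h => hv w (huniq u ▸ h)
  exact hbip ⟨fun u => hno u u, ∅, fun u _ w _ => hno u w, fun u _ w _ => hno u w⟩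

theorem mem_nbhd [Fintype V] {U : Finset V} {v : V} : v ∈ G.nbhd U ↔ ∃ u ∈ U, G.Adj u v := by
  simp [nbhd]

theorem notMem_of_mem_nbhd [Fintype V] {I : Finset V} (hI : G.IsIndep (I : Set V)) {v : V}
    (hv : v ∈ G.nbhd I) : v ∉ I := fun h => by
  obtain ⟨u, hu, huv⟩ := mem_nbhd.1 hv
  exact hI u hu v h huv

/-- In a connected graph that is not bipartite, the neighborhood of a non-empty independent set
has neighbors off that set. -/
theorem exists_adj_nbhd_notMem [Fintype V] (hconn : G.Connected) (hbip : ¬ G.IsBipartiteGraph)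
    {I : Finset V} (hne : I.Nonempty) (hI : G.IsIndep (I : Set V)) :
    ∃ e ∈ G.nbhd I, ∃ u ∉ I, G.Adj u e := by
  by_contra! h
  have hE : ∀ e ∈ G.nbhd I, ∀ u, G.Adj u e → u ∈ I := fun e he u hu => by
    by_contra hu'
    exact h e he u hu' hu
  obtain ⟨i, hi⟩ := hne
  -- If `E(I)` has neighbors only in `I`, every walk from `I` alternates between the two sets.
  have hcover : ∀ v, v ∈ I ∨ v ∈ G.nbhd I := fun v => by
    induction hconn i v with
    | refl => exact Or.inl hi
    | tail _ huv ih =>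
      rcases ih with hu | hu
      · exact Or.inr (mem_nbhd.2 ⟨_, hu, huv⟩)
      · exact Or.inl (hE _ hu _ (G.symm _ _ huv))
  have hIc : G.IsIndep (I : Set V)ᶜ := fun u hu v hv huv => by
    exact hu (hE v ((hcover v).resolve_left hv) u huv)
  refine hbip ⟨fun v hv => ?_, I, hI, hIc⟩
  by_cases h : v ∈ I
  · exact hI v h v h hv
  · exact hIc v h v h hv

theorem mem_available [Fintype V] {x : V → ℕ} {v j : V} : j ∈ G.available x v ↔ G.Adj v j ∧ 0 < x j := by
  simp [available]

/-- The largest number of stored items of one class that is compatible with `v`. -/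
noncomputable def maxNeighbor [Fintype V] (G : Multigraph V) (x : V → ℕ) (v : V) : ℕ :=
  open Classical in (Finset.univ.filter fun j => G.Adj v j).sup x

theorem lt_maxNeighbor [Fintype V] {x : V → ℕ} {v : V} {t : ℕ} :
    t < G.maxNeighbor x v ↔ ∃ j, G.Adj v j ∧ t < x j := by
  classical
  simp [maxNeighbor, Finset.lt_sup_iff]

theorem maxNeighbor_le [Fintype V] {x : V → ℕ} {v : V} {t : ℕ} :
    G.maxNeighbor x v ≤ t ↔ ∀ j, G.Adj v j → x j ≤ t := by
  classical
  simp [maxNeighbor]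

/-- There are finitely many independent sets. The cap at `1` covers the case where none is
non-empty, the infimum being then `⊤`, and bounds the loss at level `0` later on. -/
theorem exists_gap [Fintype V] {μ : PMF V} (hμ : μ ∈ G.Ncond) :
    ∃ ε : ℝ≥0∞, ε ≠ 0 ∧ ε ≤ 1 ∧ ∀ I : Finset V, I.Nonempty → G.IsIndep (I : Set V) →
      ∑ i ∈ I, μ i + ε ≤ ∑ i ∈ G.nbhd I, μ i := by
  classical
  set s := (Finset.univ : Finset (Finset V)).filter fun I : Finset V => I.Nonempty ∧ G.IsIndep (I : Set V)
  set g : Finset V → ℝ≥0∞ := fun I => ∑ i ∈ G.nbhd I, μ i - ∑ i ∈ I, μ i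
  refine ⟨min 1 (s.inf g), (lt_min one_pos ?_).ne', min_le_left _ _, fun I hne hI => ?_⟩
  · rw [Finset.lt_inf_iff ENNReal.zero_lt_top]
    intro I hI
    obtain ⟨h1, h2⟩ := (Finset.mem_filter.1 hI).2
    exact tsub_pos_of_lt (hμ.2 I h1 h2)
  · have h : min 1 (s.inf g) ≤ g I :=
      (min_le_right _ _).trans (Finset.inf_le (Finset.mem_filter.2 ⟨Finset.mem_univ _, hne, hI⟩))
    calc _ ≤ ∑ i ∈ I, μ i + g I := by gcongr
      _ = _ := add_tsub_cancel_of_le (hμ.2 I hne hI).le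

/-- Layer-cake formula. The cutoff `M` is free, so that two functions can be compared level by
level. -/
theorem expect_natCast_eq_sum_range [Fintype V] (μ : PMF V) (x : V → ℕ) {M : ℕ} (hM : ∀ v, x v ≤ M) :
    μ.expect (fun v => (x v : ℝ≥0∞))
      = ∑ t ∈ Finset.range M, ∑ v ∈ Finset.univ.filter (fun v => t < x v), μ v := by
  have hx : ∀ v, (x v : ℝ≥0∞) = ∑ t ∈ Finset.range M, if t < x v then 1 else 0 := by
    intro v
    have : (Finset.range M).filter (· < x v) = Finset.range (x v) := by
      ext t
      have := hM v
      simp only [Finset.mem_filter, Finset.mem_range]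
      omega
    rw [Finset.sum_boole, this, Finset.card_range]
  rw [PMF.expect_eq_sum]
  simp only [hx, Finset.mul_sum, Finset.sum_filter]
  rw [Finset.sum_comm]
  simp only [mul_ite, mul_one, mul_zero]

/-! ### Queue details and irreducibility of their chain -/

variable [DecidableEq V]

theorem isQueueDetail_nil : G.IsQueueDetail [] := by
  constructor <;> simp

theorem IsQueueDetail.of_append {w : List V} {v : V} (h : G.IsQueueDetail (w ++ [v])) :
    G.IsQueueDetail w := by
  have hle : ∀ i, w.count i ≤ (w ++ [v]).count i := fun i =>
    (List.sublist_append_left w [v]).count_le i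
  refine ⟨fun i k hik hadj => ?_, fun i hi => (hle i).trans (h.2 i hi)⟩
  exact Nat.le_zero.mp ((Nat.mul_le_mul (hle i) (hle k)).trans (h.1 i k hik hadj).le)

/-- Level `0` is excluded because a class with a self-loop may hold one item, but never two. -/
theorem IsQueueDetail.isIndep_lt [Fintype V] {w : List V} (hw : G.IsQueueDetail w) {t : ℕ}
    (ht : t ≠ 0) : G.IsIndep ((Finset.univ.filter fun v => t < w.count v : Finset V) : Set V) := by
  intro u hu v hv huv
  simp only [Finset.coe_filter, Finset.mem_univ, true_and, Set.mem_ofPred_eq] at hu hv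
  by_cases h : u = v
  · subst h
    have := hw.2 u huv
    omega
  · have := hw.1 u v h huv
    rcases Nat.mul_eq_zero.1 this with h0 | h0 <;> omega

variable [Fintype V]

theorem IsQueueDetail.not_available {w : List V} {v : V} (h : G.IsQueueDetail (w ++ [v])) :
    ¬ (G.available (classDetail w) v).Nonempty := by
  rintro ⟨j, hj⟩
  obtain ⟨hadj, hpos⟩ := mem_available.1 hj
  simp only [classDetail] at hpos
  by_cases hjv : j = v
  · subst hjv
    have := h.2 j hadj
    simp only [List.count_append, List.count_singleton_self] at this
    omega
  · have := h.1 v j (Ne.symm hjv) hadj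
    simp only [List.count_append, List.count_singleton_self, Nat.mul_eq_zero] at this
    omega

theorem arrival_ne_zero {Φ : G.ClassPolicy} {w y : G.QueueDetail} {v : V}
    (h : G.arrival Φ w v y ≠ 0) :
    (¬ (G.available (classDetail w.1) v).Nonempty ∧ y.1 = w.1 ++ [v]) ∨
      ∃ j, ∃ ha : (G.available (classDetail w.1) v).Nonempty,
        j ∈ (Φ.choice (classDetail w.1) v ha).support ∧ y.1 = w.1.erase j := by
  unfold arrival at h
  split_ifs at h with ha
  · right
    rw [← PMF.mem_support_iff, PMF.mem_support_map_iff] at h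
    obtain ⟨j, hj, rfl⟩ := h
    exact ⟨j, ha, hj, rfl⟩
  · left
    rw [← PMF.mem_support_iff, PMF.mem_support_pure_iff] at h
    exact ⟨ha, by rw [h]⟩

theorem adj_and_mem_of_mem_support {Φ : G.ClassPolicy} {w : List V} {v j : V}
    {ha : (G.available (classDetail w) v).Nonempty}
    (hj : j ∈ (Φ.choice (classDetail w) v ha).support) : G.Adj v j ∧ j ∈ w := by
  have h := mem_available.1 (Φ.support_subset _ _ _ hj)
  exact ⟨h.1, List.count_pos_iff.1 h.2⟩

theorem transition_ne_zero {Φ : G.ClassPolicy} {μ : PMF V} {w y : G.QueueDetail} :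
    G.transition Φ μ w y ≠ 0 ↔ ∃ v, μ v ≠ 0 ∧ G.arrival Φ w v y ≠ 0 := by
  rw [transition, ← PMF.mem_support_iff, PMF.mem_support_bind_iff]
  rfl

theorem transition_append_ne_zero (Φ : G.ClassPolicy) {μ : PMF V}
    (hμ : μ ∈ fullSupportMeasures V) {w : List V} {v : V} (h : G.IsQueueDetail (w ++ [v])) :
    G.transition Φ μ ⟨w, h.of_append⟩ ⟨w ++ [v], h⟩ ≠ 0 := by
  refine transition_ne_zero.2 ⟨v, hμ v, ?_⟩
  simp [arrival, h.not_available]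

theorem exists_transition_length_lt (hnb : ∀ v, ∃ u, G.Adj v u) (Φ : G.ClassPolicy) {μ : PMF V}
    (hμ : μ ∈ fullSupportMeasures V) (w : G.QueueDetail) (hw : w.1 ≠ []) :
    ∃ y, G.transition Φ μ w y ≠ 0 ∧ y.1.length < w.1.length := by
  obtain ⟨i, hi⟩ := List.exists_mem_of_ne_nil _ hw
  obtain ⟨v, hv⟩ := hnb i
  have ha : (G.available (classDetail w.1) v).Nonempty :=
    ⟨i, mem_available.2 ⟨G.symm _ _ hv, List.count_pos_iff.2 hi⟩⟩
  obtain ⟨y, hy⟩ := (G.arrival Φ w v).support_nonempty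
  refine ⟨y, transition_ne_zero.2 ⟨v, hμ v, hy⟩, ?_⟩
  rcases arrival_ne_zero hy with ⟨h, _⟩ | ⟨j, ha', hj, hyj⟩
  · exact absurd ha h
  · have hjw := (adj_and_mem_of_mem_support hj).2
    have := List.length_pos_of_mem hjw
    rw [hyj, List.length_erase_of_mem hjw]
    omega

/-- The chain of queue details is irreducible. -/
theorem transition_irreducible (hnb : ∀ v, ∃ u, G.Adj v u) (Φ : G.ClassPolicy) {μ : PMF V}
    (hμ : μ ∈ fullSupportMeasures V) (w y : G.QueueDetail) :
    Relation.ReflTransGen (fun w y => G.transition Φ μ w y ≠ 0) w y := by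
  -- Every word can be emptied by successive matches, and rebuilt from the empty word by storing its
  -- letters in order.
  have hdown : ∀ (n : ℕ) (w : G.QueueDetail), w.1.length = n →
      Relation.ReflTransGen (fun w y => G.transition Φ μ w y ≠ 0) w ⟨[], isQueueDetail_nil⟩ := by
    intro n
    induction n using Nat.strong_induction_on with
    | _ n ih =>
      intro w hw
      by_cases h : w.1 = []
      · have : w = ⟨[], isQueueDetail_nil⟩ := Subtype.ext h
        rw [this]
      · obtain ⟨y, hy, hlt⟩ := exists_transition_length_lt hnb Φ hμ w h
        exact Relation.ReflTransGen.head hy (ih _ (hw ▸ hlt) y rfl)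
  have hup : ∀ (l : List V) (hl : G.IsQueueDetail l),
      Relation.ReflTransGen (fun w y => G.transition Φ μ w y ≠ 0) ⟨[], isQueueDetail_nil⟩
        ⟨l, hl⟩ := by
    intro l
    induction l using List.reverseRecOn with
    | nil => intro _; exact Relation.ReflTransGen.refl
    | append_singleton l v ih =>
      intro hl
      exact (ih hl.of_append).tail (transition_append_ne_zero Φ hμ hl)
  exact (hdown _ w rfl).trans (hup y.1 y.2)

theorem expect_transition (Φ : G.ClassPolicy) (μ : PMF V) (w : G.QueueDetail)
    (g : G.QueueDetail → ℝ≥0∞) :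
    (G.transition Φ μ w).expect g = μ.expect fun v => (G.arrival Φ w v).expect g :=
  PMF.expect_bind _ _ _

theorem expect_arrival_add_le (Φ : G.ClassPolicy) (w : G.QueueDetail) (v : V)
    {f g : G.QueueDetail → ℝ≥0∞} {A B : ℝ≥0∞}
    (h : ∀ y, G.arrival Φ w v y ≠ 0 → f y + A ≤ g y + B) :
    (G.arrival Φ w v).expect f + A ≤ (G.arrival Φ w v).expect g + B := by
  have := (G.arrival Φ w v).expect_mono h
  rwa [PMF.expect_add, PMF.expect_add, PMF.expect_const, PMF.expect_const] at this

theorem length_le_of_transition {Φ : G.ClassPolicy} {μ : PMF V} {w y : G.QueueDetail}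
    (h : G.transition Φ μ w y ≠ 0) : y.1.length ≤ w.1.length + 1 := by
  obtain ⟨v, _, hv⟩ := transition_ne_zero.1 h
  rcases arrival_ne_zero hv with ⟨_, hy⟩ | ⟨j, _, _, hy⟩
  · simp [hy]
  · rw [hy]
    exact List.length_erase_le.trans (Nat.le_succ _)

/-! ### Necessity of the condition, for any policy -/

/-- The effect of one arrival on the number of stored items with classes in an independent set `I`,
compared with the number of those with classes in `E(I)`. The last term on the left
records a match of two items neither of which is in `I`. -/
theorem countP_arrival_le {Φ : G.ClassPolicy} {I : Finset V} (hI : G.IsIndep (I : Set V))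
    {e u : V} (he : e ∈ G.nbhd I) (hu : u ∉ I) (hue : G.Adj u e) {w y : G.QueueDetail} {v : V}
    (h : G.arrival Φ w v y ≠ 0) :
    y.1.countP (· ∈ G.nbhd I) + (w.1.countP (· ∈ I) + (if v ∈ I then 1 else 0)
        + (if w.1 = [e] ∧ v = u then 1 else 0))
      ≤ y.1.countP (· ∈ I) + (w.1.countP (· ∈ G.nbhd I) + (if v ∈ G.nbhd I then 1 else 0)) := by
  rcases arrival_ne_zero h with ⟨ha, hy⟩ | ⟨j, ha, hj, hy⟩
  · have hb : ¬ (w.1 = [e] ∧ v = u) := by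
      rintro ⟨hw, rfl⟩
      exact ha ⟨e, mem_available.2 ⟨hue, by simp [classDetail, hw]⟩⟩
    rw [hy, if_neg hb]
    simp only [List.countP_append, List.countP_singleton, decide_eq_true_eq]
    omega
  · obtain ⟨hadj, hjw⟩ := adj_and_mem_of_mem_support hj
    have hpos : ∀ J : Finset V, j ∈ J → 0 < w.1.countP (· ∈ J) := fun J hJ =>
      List.countP_pos_iff.2 ⟨j, hjw, by simpa using hJ⟩
    have h1 := hpos I
    have h2 := hpos (G.nbhd I)
    -- A matched item of `I` has its partner in `E(I)`. The match of `e` with `u` removes an item of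
    -- `E(I)` without using an arrival from `I`, hence the extra unit.
    have h3 : v ∈ I → j ∈ G.nbhd I := fun hv => mem_nbhd.2 ⟨v, hv, hadj⟩
    have h4 : j ∈ I → v ∈ G.nbhd I := fun hj => mem_nbhd.2 ⟨j, hj, G.symm _ _ hadj⟩
    have h5 : w.1 = [e] ∧ v = u → j ∈ G.nbhd I ∧ j ∉ I ∧ v ∉ I := by
      rintro ⟨hw, rfl⟩
      rw [hw, List.mem_singleton] at hjw
      subst hjw
      exact ⟨he, notMem_of_mem_nbhd hI he, hu⟩
    rw [hy, List.countP_erase, List.countP_erase]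
    simp only [hjw, decide_eq_true_eq, true_and]
    generalize w.1.countP (· ∈ I) = p at *
    generalize w.1.countP (· ∈ G.nbhd I) = q at *
    clear hpos
    grind

theorem stab_subset_ncond (hconn : G.Connected) (hbip : ¬ G.IsBipartiteGraph)
    (Φ : G.ClassPolicy) : G.Stab Φ ⊆ G.Ncond := by
  rintro μ ⟨hμ, hpr⟩
  refine ⟨hμ, fun I hne hI => ?_⟩
  by_contra! hle
  obtain ⟨e, he, u, hu, hue⟩ := exists_adj_nbhd_notMem hconn hbip hne hI
  have hq : G.IsQueueDetail ([] ++ [e]) :=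
    isQueueDetail_nil.append (by rintro ⟨j, hj⟩; simp [mem_available, classDetail] at hj)
  -- The strict gain `μ u` occurs at the word `[e]`, reached from the empty word when `e` arrives.
  refine not_positiveRecurrent_of_drift (G.transition Φ μ) ⟨[], isQueueDetail_nil⟩ ⟨[] ++ [e], hq⟩
    (fun w => w.1.length) (fun w y => length_le_of_transition) rfl
    (fun w => (w.1.countP (· ∈ I) : ℕ)) (fun w => (w.1.countP (· ∈ G.nbhd I) : ℕ))
    (fun w => if w.1 = [e] then μ u else 0)
    (fun w => Nat.cast_le.2 List.countP_le_length) (fun w => Nat.cast_le.2 List.countP_le_length)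
    (fun w => ?_) (by simp [Subtype.ext_iff]) (transition_append_ne_zero Φ hμ hq)
    (by simpa using hμ u) hpr
  have hfin : ∑ i ∈ G.nbhd I, μ i ≠ ⊤ := ((μ.sum_le_one _).trans_lt ENNReal.one_lt_top).ne
  refine (ENNReal.add_le_add_iff_right hfin).1 ?_
  have hv : ∀ v, _ := fun v => expect_arrival_add_le Φ w v
    (f := fun y => (y.1.countP (· ∈ G.nbhd I) : ℕ)) (g := fun y => (y.1.countP (· ∈ I) : ℕ))
    (A := (w.1.countP (· ∈ I) : ℕ) + (if v ∈ I then 1 else 0)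
        + (if w.1 = [e] ∧ v = u then 1 else 0))
    (B := (w.1.countP (· ∈ G.nbhd I) : ℕ) + (if v ∈ G.nbhd I then 1 else 0))
    (fun y hy => by exact_mod_cast countP_arrival_le hI he hu hue hy)
  have hsum := μ.expect_mono fun v _ => hv v
  simp only [PMF.expect_add, PMF.expect_const, PMF.expect_ite_mem, ← expect_transition] at hsum
  have hbonus : μ.expect (fun v => if w.1 = [e] ∧ v = u then 1 else 0)
      = if w.1 = [e] then μ u else 0 := by
    by_cases hw : w.1 = [e]
    · simpa [hw] using μ.expect_ite_mem {u}
    · simpa [hw] using μ.expect_const 0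
  rw [hbonus] at hsum
  -- The assumption `μ(E(I)) ≤ μ(I)` enters here.
  calc _ ≤ ((w.1.countP (· ∈ I) : ℕ) : ℝ≥0∞)
        + (G.transition Φ μ w).expect (fun y => (y.1.countP (· ∈ G.nbhd I) : ℕ))
        + (if w.1 = [e] then μ u else 0) + ∑ i ∈ I, μ i := by gcongr
    _ ≤ _ := by
      refine le_of_eq_of_le ?_ (hsum.trans_eq ?_) <;> ring

/-! ### Sufficiency of the condition, for Max-Weight -/

/-- Each level `1 ≤ t < max x` contributes a gap `ε`, as `{x > t}` is then independent and
non-empty, with neighborhood `{m > t}`. Level `0` may fail to be independent; the `2` on the right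
pays for it. -/
theorem expect_count_add_le {μ : PMF V} {ε : ℝ≥0∞} (hε : ε ≤ 1)
    (hgap : ∀ I : Finset V, I.Nonempty → G.IsIndep (I : Set V) →
      ∑ i ∈ I, μ i + ε ≤ ∑ i ∈ G.nbhd I, μ i) {w : List V} (hw : G.IsQueueDetail w) :
    μ.expect (fun v => (classDetail w v : ℝ≥0∞)) + (Finset.univ.sup (classDetail w) : ℕ) * ε
      ≤ μ.expect (fun v => (G.maxNeighbor (classDetail w) v : ℝ≥0∞)) + 2 := by
  set x := classDetail w with hx
  set M := Finset.univ.sup x with hMdef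
  have hM : ∀ v, x v ≤ M := fun v => Finset.le_sup (Finset.mem_univ v)
  have hm : ∀ v, G.maxNeighbor x v ≤ M := fun v => maxNeighbor_le.2 fun j _ => hM j
  rw [expect_natCast_eq_sum_range μ x hM, expect_natCast_eq_sum_range μ _ hm]
  have hnb : ∀ t, (Finset.univ.filter fun v => t < G.maxNeighbor x v)
      = G.nbhd (Finset.univ.filter fun v => t < x v) := by
    intro t
    ext v
    simp only [Finset.mem_filter, Finset.mem_univ, true_and, mem_nbhd, lt_maxNeighbor]
    exact ⟨fun ⟨j, h1, h2⟩ => ⟨j, h2, G.symm _ _ h1⟩, fun ⟨j, h1, h2⟩ => ⟨j, G.symm _ _ h2, h1⟩⟩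
  have hterm : ∀ t ∈ Finset.range M,
      ∑ v ∈ Finset.univ.filter (fun v => t < x v), μ v + ε
        ≤ ∑ v ∈ Finset.univ.filter (fun v => t < G.maxNeighbor x v), μ v
          + if t = 0 then 2 else 0 := by
    intro t ht
    by_cases h0 : t = 0
    · rw [if_pos h0, ← one_add_one_eq_two]
      exact (add_le_add (μ.sum_le_one _) hε).trans le_add_self
    · rw [if_neg h0, add_zero, hnb]
      refine hgap _ ?_ (hw.isIndep_lt h0)
      obtain ⟨v, _, hv⟩ := Finset.lt_sup_iff.1 (Finset.mem_range.1 ht)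
      exact ⟨v, by simpa using hv⟩
  have hsum := Finset.sum_le_sum hterm
  rw [Finset.sum_add_distrib, Finset.sum_add_distrib, Finset.sum_const, Finset.card_range,
    nsmul_eq_mul, Finset.sum_ite_eq'] at hsum
  refine hsum.trans ?_
  gcongr
  split_ifs <;> simp

/-- A class drawn by the Max-Weight policy has, up to a constant, as many stored items as any other
available class. -/
theorem exists_maximizers_bound (G : Multigraph V) {β : ℝ} (hβ : 0 < β) (r : Sym2 V → ℝ) :
    ∃ C : ℕ, ∀ {w : List V}, G.IsQueueDetail w → ∀ {v j : V},
      j ∈ G.maximizers β r (classDetail w) v →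
        G.maxNeighbor (classDetail w) v ≤ classDetail w j + C := by
  -- `R` bounds the effect of the rewards in units of `β`. The extra `1` in `C` pays for self-loops:
  -- `{v, v}` is a singleton, so its weight counts `x v` only once, and then `x v ≤ 1`.
  obtain ⟨R, hR⟩ := (Set.finite_range fun p : Sym2 V × Sym2 V => (r p.1 - r p.2) / β).bddAbove
  obtain ⟨C, hC⟩ := exists_nat_ge (R + 1)
  refine ⟨C, fun {w} hw {v j} hj => maxNeighbor_le.2 fun k hk => ?_⟩
  set x := classDetail w with hx
  by_cases hk0 : x k = 0
  · omega
  obtain ⟨-, hmax⟩ := Finset.mem_filter.1 hj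
  have hle := hmax k (mem_available.2 ⟨hk, Nat.pos_of_ne_zero hk0⟩)
  have hRjk : r s(v, j) - r s(v, k) ≤ R * β :=
    (div_le_iff₀ hβ).1 (hR ⟨(s(v, j), s(v, k)), rfl⟩)
  have hup : ∑ i ∈ ({v, j} : Finset V), (x i : ℝ) ≤ x v + x j := by
    by_cases hvj : v = j
    · subst hvj; simp
    · rw [Finset.sum_pair hvj]
  have hlow : (x v : ℝ) + x k - 1 ≤ ∑ i ∈ ({v, k} : Finset V), (x i : ℝ) := by
    by_cases hvk : v = k
    · subst hvk
      have : (x v : ℝ) ≤ 1 := by exact_mod_cast hw.2 v hk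
      simp only [Finset.pair_eq_singleton, Finset.sum_singleton]
      linarith
    · rw [Finset.sum_pair hvk]
      linarith
  have h1 := mul_le_mul_of_nonneg_left hup hβ.le
  have h2 := mul_le_mul_of_nonneg_left hlow hβ.le
  simp only [weight] at hle
  have h3 : β * (x k : ℝ) ≤ β * (x j + (R + 1)) := by nlinarith
  have h4 : (x k : ℝ) ≤ x j + C := (le_of_mul_le_mul_left h3 hβ).trans (by linarith)
  exact_mod_cast h4

/-- The quadratic Lyapunov function. -/
def sumSq (w : List V) : ℕ := ∑ i, w.count i ^ 2

theorem sumSq_append (w : List V) (v : V) :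
    sumSq (w ++ [v]) = sumSq w + 2 * w.count v + 1 := by
  unfold sumSq
  rw [← Finset.add_sum_erase _ _ (Finset.mem_univ v),
    ← Finset.add_sum_erase (a := v) _ (fun i => w.count i ^ 2) (Finset.mem_univ v)]
  have : ∀ i ∈ Finset.univ.erase v, (w ++ [v]).count i ^ 2 = w.count i ^ 2 := fun i hi => by
    simp [List.count_append, (Finset.ne_of_mem_erase hi).symm]
  rw [Finset.sum_congr rfl this, List.count_append, List.count_singleton_self]
  ring

theorem sumSq_erase {w : List V} {j : V} (hj : j ∈ w) :
    sumSq (w.erase j) + 2 * w.count j = sumSq w + 1 := by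
  unfold sumSq
  rw [← Finset.add_sum_erase _ _ (Finset.mem_univ j),
    ← Finset.add_sum_erase (a := j) _ (fun i => w.count i ^ 2) (Finset.mem_univ j)]
  have : ∀ i ∈ Finset.univ.erase j, (w.erase j).count i ^ 2 = w.count i ^ 2 := fun i hi => by
    rw [List.count_erase_of_ne (Finset.ne_of_mem_erase hi)]
  rw [Finset.sum_congr rfl this, List.count_erase_self]
  obtain ⟨k, hk⟩ := Nat.exists_eq_succ_of_ne_zero (List.count_pos_iff.2 hj).ne'
  rw [hk, Nat.succ_sub_one]
  simp only [Nat.succ_eq_add_one]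
  ring

/-- A stored item adds `2 x(v) + 1`, and then `m(v) = 0`; a match with `j` adds `1 - 2 x(j)`, where
`x(j) ≥ m(v) - C`. One bound covers both cases. -/
theorem sumSq_arrival_le {β : ℝ} {r : Sym2 V → ℝ} {C : ℕ}
    (hC : ∀ {w : List V}, G.IsQueueDetail w → ∀ {v j : V},
      j ∈ G.maximizers β r (classDetail w) v →
        G.maxNeighbor (classDetail w) v ≤ classDetail w j + C)
    {w y : G.QueueDetail} {v : V} (h : G.arrival (G.maxWeight β r) w v y ≠ 0) :
    sumSq y.1 + 2 * G.maxNeighbor (classDetail w.1) v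
      ≤ sumSq w.1 + (2 * classDetail w.1 v + (2 * C + 1)) := by
  rcases arrival_ne_zero h with ⟨ha, hy⟩ | ⟨j, ha, hj, hy⟩
  · have h0 : G.maxNeighbor (classDetail w.1) v ≤ 0 := by
      refine maxNeighbor_le.2 fun k hk => ?_
      by_contra hpos
      exact ha ⟨k, mem_available.2 ⟨hk, by omega⟩⟩
    rw [hy, sumSq_append]
    simp only [classDetail] at *
    omega
  · have hjw := (adj_and_mem_of_mem_support hj).2
    have hm := hC w.2
      ((PMF.mem_support_uniformOfFinset_iff (G.maximizers_nonempty β r _ v ha) j).1 hj)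
    have hs := sumSq_erase hjw
    rw [hy]
    simp only [classDetail] at *
    omega

theorem finite_setOf_sup_classDetail_lt (G : Multigraph V) (K : ℕ) :
    {w : G.QueueDetail | Finset.univ.sup (classDetail w.1) < K}.Finite := by
  refine Set.Finite.of_finite_image (f := Subtype.val) ?_ Subtype.val_injective.injOn
  refine (List.finite_length_le V (Fintype.card V * K)).subset ?_
  rintro _ ⟨w, hw, rfl⟩
  have hlen : w.1.length = ∑ i, w.1.count i := by
    have := Multiset.sum_count_eq_card (s := Finset.univ) (m := (w.1 : Multiset V)) (by simp)
    simpa using this.symm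
  have : ∑ i, w.1.count i ≤ ∑ _i : V, K := Finset.sum_le_sum fun i _ =>
    (Finset.le_sup (f := classDetail w.1) (Finset.mem_univ i)).trans (le_of_lt hw)
  simpa [hlen] using this

theorem ncond_subset_stab (hconn : G.Connected) (hbip : ¬ G.IsBipartiteGraph) {β : ℝ}
    (hβ : 0 < β) (r : Sym2 V → ℝ) : G.Ncond ⊆ G.Stab (G.maxWeight β r) := by
  intro μ hμ
  refine ⟨hμ.1, ?_⟩
  obtain ⟨ε, hε0, hε1, hgap⟩ := exists_gap hμ
  obtain ⟨C, hC⟩ := G.exists_maximizers_bound hβ r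
  -- `2 * C + 1` comes from one arrival, and `4` is twice the cost of level `0`.
  set D : ℝ≥0∞ := 2 * C + 1 + 4 with hD
  have hDtop : D ≠ ⊤ := by simp [hD, ENNReal.mul_eq_top]
  have hdrift : ∀ w : G.QueueDetail,
      (G.transition (G.maxWeight β r) μ w).expect (fun y => (sumSq y.1 : ℝ≥0∞))
        + 2 * ((Finset.univ.sup (classDetail w.1) : ℕ) * ε) ≤ sumSq w.1 + D := by
    intro w
    have hv : ∀ v, _ := fun v => expect_arrival_add_le (G.maxWeight β r) w v
      (f := fun y => (sumSq y.1 : ℝ≥0∞)) (g := fun _ => (sumSq w.1 : ℝ≥0∞))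
      (A := 2 * (G.maxNeighbor (classDetail w.1) v : ℝ≥0∞))
      (B := 2 * (classDetail w.1 v : ℝ≥0∞) + (2 * C + 1))
      (fun y hy => by exact_mod_cast sumSq_arrival_le hC hy)
    have hsum := μ.expect_mono fun v _ => hv v
    simp only [PMF.expect_add, PMF.expect_const, PMF.expect_const_mul, ← expect_transition] at hsum
    have hcake := expect_count_add_le hε1 hgap w.2
    have htop : ∀ x : V → ℕ, μ.expect (fun v => (x v : ℝ≥0∞)) ≠ ⊤ := fun x => by
      rw [PMF.expect_eq_sum]
      exact ENNReal.sum_ne_top.2 fun v _ =>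
        ENNReal.mul_ne_top (μ.apply_ne_top v) (ENNReal.natCast_ne_top _)
    have hX := htop (classDetail w.1)
    have hY := htop (G.maxNeighbor (classDetail w.1))
    set X := μ.expect (fun v => (classDetail w.1 v : ℝ≥0∞))
    set Y := μ.expect (fun v => (G.maxNeighbor (classDetail w.1) v : ℝ≥0∞))
    -- The two mean inequalities are added, and the finite terms `2 * X + 2 * Y` cancel.
    have hXY : 2 * X + 2 * Y ≠ ⊤ := by simp [ENNReal.mul_eq_top, hX, hY]
    refine (ENNReal.add_le_add_iff_right hXY).1 ?_
    have := add_le_add hsum (mul_le_mul_right hcake 2)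
    refine le_of_eq_of_le ?_ (this.trans_eq ?_)
    · ring
    · rw [hD]; ring
  -- Once some class holds `K` items, the negative drift exceeds `D` by at least `1`; only finitely
  -- many words stay below `K` in every class.
  obtain ⟨K, hK⟩ := ENNReal.exists_nat_mul_gt hε0 (ENNReal.add_ne_top.2 ⟨hDtop, ENNReal.one_ne_top⟩)
  refine positiveRecurrent_of_drift _ (transition_irreducible (exists_adj hconn hbip) _ hμ.1)
    (fun w => (sumSq w.1 : ℝ≥0∞)) (fun w => ENNReal.natCast_ne_top _)
    (finite_setOf_sup_classDetail_lt G K).toFinset (D + 1)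
    (ENNReal.add_ne_top.2 ⟨hDtop, ENNReal.one_ne_top⟩) (fun w _ => ?_) (fun w hw => ?_)
  · rw [← add_assoc]
    gcongr
    exact le_self_add.trans (hdrift w)
  · have hw' : K ≤ Finset.univ.sup (classDetail w.1) := by simpa using hw
    refine (ENNReal.add_le_add_iff_right hDtop).1 (le_trans ?_ (hdrift w))
    rw [add_assoc, add_comm 1 D]
    gcongr
    calc D + 1 ≤ K * ε := hK.le
      _ ≤ (Finset.univ.sup (classDetail w.1) : ℕ) * ε := by gcongr
      _ ≤ _ := by rw [two_mul]; exact le_self_add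

end Multigraph

theorem mainTheorem2 {V : Type*} [Fintype V] [DecidableEq V] (G : Multigraph V)
    (hconn : G.Connected) (hbip : ¬ G.IsBipartiteGraph)
    (β : ℝ) (hβ : 0 < β) (r : Sym2 V → ℝ) :
    G.Stab (G.maxWeight β r) = G.Ncond :=
  (G.stab_subset_ncond hconn hbip _).antisymm (G.ncond_subset_stab hconn hbip hβ r)
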